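/- Let $|A|$ denote the Lebesgue measure of $A\subset\mathbb{R}^n$. A convex body is a compact convex set with nonempty interior, it is called symmetric if $-A=A$, and an ellipsoid is the image of the closed Euclidean unit ball under an invertible affine map. For a convex body $A\subset\mathbb{R}^n$ put $$M(A)=\sup_{|\mathcal E|=|A|}\frac{|A\cap\mathcal E|^{1/n}}{|A|^{1/n}},$$ the supremum being over all ellipsoids $\mathcal E$ with $|\mathcal E|=|A|$. An ellipsoid $\mathcal E$ with $|\mathcal E|=|A|$ is an $M$-ellipsoid of $A$ with constant $c$ if $|A\cap\mathcal E|^{1/n}\ge c\,|A|^{1/n}$; and $A$ is in $M$-position with constant $c$ if the closed Euclidean ball $D$ centered at the origin with $|D|=|A|$ satisfies $|A\cap D|^{1/n}\ge c\,|A|^{1/n}$. The existence of $M$-ellipsoids for symmetric convex bodies is equivalent to the reverse Brunn--Minkowski inequality. Precisely, the following four statements are equivalent: 1. There is a universal constant $c>0$ such that $M(A)\ge c$ for every $n\ge1$ and every symmetric convex body $A\subset\mathbb{R}^n$. 2. There is a universal constant $c>0$ such that for every $n\ge1$ every symmetric convex body $A\subset\mathbb{R}^n$ has an $M$-ellipsoid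 with constant $c$. 3. There is a universal constant $C>0$ such that for every $n\ge1$ and all symmetric convex bodies $A,B\subset\mathbb{R}^n$ there are linear volume preserving maps $u_1,u_2:\mathbb{R}^n\to\mathbb{R}^n$ with $|u_1(A)+u_2(B)|^{1/n}\le C\,(|A|^{1/n}+|B|^{1/n})$. 4. The same as 3, for all (not necessarily symmetric) convex bodies $A,B\subset\mathbb{R}^n$. Moreover, the equivalence holds at the level of individual bodies: (a) For every $c>0$ there is $C>0$, depending only on $c$, such that for every $n\ge1$ and all symmetric convex bodies $A,B\subset\mathbb{R}^n$ in $M$-position with constant $c$, one has $|A+B|^{1/n}\le C\,(|A|^{1/n}+|B|^{1/n})$. (b) For every $C>0$ there is $c>0$, depending only on $C$, such that for every $n\ge1$ and every symmetric convex body $A\subset\mathbb{R}^n$, if the closed ball $D$ centered at the origin with $|D|=|A|$ satisfies $|A+D|^{1/n}\le C\,(|A|^{1/n}+|D|^{1/n})$, then $A$ is in $M$-position with constant $c$. -/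

import Mathlib

open MeasureTheory
open scoped Pointwise

noncomputable section

/-- `volRoot A` is `|A|^{1/n}`, where `|A|` is the Lebesgue measure of `A ⊆ ℝⁿ`. -/
def volRoot {n : ℕ} (A : Set (EuclideanSpace ℝ (Fin n))) : ℝ :=
  (volume.real A) ^ (1 / (n : ℝ))

/-- A convex body in `ℝⁿ`: a compact convex set with nonempty interior. -/
def IsConvBody {n : ℕ} (A : Set (EuclideanSpace ℝ (Fin n))) : Prop :=
  Convex ℝ A ∧ IsCompact A ∧ (interior A).Nonempty

/-- A convex body which is symmetric about the origin. -/
def IsSymmConvBody {n : ℕ} (A : Set (EuclideanSpace ℝ (Fin n))) : Prop :=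
  IsConvBody A ∧ -A = A

/-- An ellipsoid in `ℝⁿ` (with arbitrary center): the image of the closed unit ball under an
invertible affine map. -/
def IsEllipsoid {n : ℕ} (E : Set (EuclideanSpace ℝ (Fin n))) : Prop :=
  ∃ T : EuclideanSpace ℝ (Fin n) ≃ᵃ[ℝ] EuclideanSpace ℝ (Fin n),
    E = T '' Metric.closedBall 0 1

/-- `M(A) = sup |A ∩ E|^{1/n} / |A|^{1/n}`, over all ellipsoids `E` with `|E| = |A|`. -/
def milmanM {n : ℕ} (A : Set (EuclideanSpace ℝ (Fin n))) : ℝ :=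
  sSup {t : ℝ | ∃ E : Set (EuclideanSpace ℝ (Fin n)),
    IsEllipsoid E ∧ volume E = volume A ∧ t = volRoot (A ∩ E) / volRoot A}

/-- `E` is an `M`-ellipsoid of `A` with constant `c`. -/
def IsMEllipsoid {n : ℕ} (c : ℝ) (A E : Set (EuclideanSpace ℝ (Fin n))) : Prop :=
  IsEllipsoid E ∧ volume E = volume A ∧ c * volRoot A ≤ volRoot (A ∩ E)

/-- `A` is in `M`-position with constant `c`: the ball `D` centered at the origin with
`|D| = |A|` satisfies `|A ∩ D|^{1/n} ≥ c |A|^{1/n}`. -/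
def InMPosition {n : ℕ} (c : ℝ) (A : Set (EuclideanSpace ℝ (Fin n))) : Prop :=
  ∃ r : ℝ, 0 < r ∧ volume (Metric.closedBall (0 : EuclideanSpace ℝ (Fin n)) r) = volume A ∧
    c * volRoot A ≤ volRoot (A ∩ Metric.closedBall 0 r)

/-- The pair `A, B` satisfies the reverse Brunn-Minkowski inequality with constant `C`, after
application of suitable linear volume preserving maps. -/
def ReverseBM {n : ℕ} (C : ℝ) (A B : Set (EuclideanSpace ℝ (Fin n))) : Prop :=
  ∃ u₁ u₂ : EuclideanSpace ℝ (Fin n) ≃ₗ[ℝ] EuclideanSpace ℝ (Fin n),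
    MeasurePreserving u₁ volume volume ∧ MeasurePreserving u₂ volume volume ∧
      volRoot (u₁ '' A + u₂ '' B) ≤ C * (volRoot A + volRoot B)

end

/-! ### Sumset and intersection inequalities for Haar measure. -/

section Haar

variable {E : Type*} [NormedAddCommGroup E] [NormedSpace ℝ E] [FiniteDimensional ℝ E]
  [MeasurableSpace E] [BorelSpace E] (μ : Measure E) [μ.IsAddHaarMeasure]

/-! Two estimates link sums with intersections, losing only factors exponential in `n`, hence
constants after `n`-th roots. Averaging: `|A ∩ (x - B)|` has integral `|A||B|` and vanishes for `x`
outside `A + B`, so a small sum forces a large intersection with some `x - B`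
(`exists_measureReal_mul_le`). With `B` an image of the ball, this produces an ellipsoid from
reverse Brunn-Minkowski. Ruzsa: if `K`, `L` are symmetric and `A + K`, `B + L` are not much larger
than `K`, `L`, then `A + B` is not much larger than `K + L` (`measureReal_add_le_of_symm`). In
`M`-position take `K`, `L` to be the intersections with the balls: `A + K ⊆ 2A`, and `K + L` lies in
a sum of concentric balls, whose volume radii add. For general bodies take `K`, `L` to be large
symmetric parts. Symmetry allows ellipsoids to be recentred at the cost of a factor 2. -/

lemma lintegral_measure_inter_sub {A B : Set E} (hA : MeasurableSet A) (hB : MeasurableSet B) :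
    ∫⁻ x, μ (A ∩ {y | x - y ∈ B}) ∂μ = μ A * μ B := by
  have hS : MeasurableSet {p : E × E | p.2 ∈ A ∧ p.1 - p.2 ∈ B} :=
    (measurable_snd hA).inter ((measurable_fst.sub measurable_snd) hB)
  have h1 := Measure.prod_apply (μ := μ) (ν := μ) hS
  have h2 := Measure.prod_apply_symm (μ := μ) (ν := μ) hS
  have h3 : ∀ y, μ ((fun x => (x, y)) ⁻¹' {p : E × E | p.2 ∈ A ∧ p.1 - p.2 ∈ B}) =
      A.indicator (fun _ => μ B) y := by
    intro y
    by_cases hy : y ∈ A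
    · have : (fun x => (x, y)) ⁻¹' {p : E × E | p.2 ∈ A ∧ p.1 - p.2 ∈ B} =
          (fun x => x + -y) ⁻¹' B := by
        ext x; simp [hy, sub_eq_add_neg]
      rw [this, measure_preimage_add_right, Set.indicator_of_mem hy]
    · have : (fun x => (x, y)) ⁻¹' {p : E × E | p.2 ∈ A ∧ p.1 - p.2 ∈ B} = ∅ := by
        ext x; simp [hy]
      rw [this, measure_empty, Set.indicator_of_notMem hy]
  simp_rw [h3] at h2
  rw [lintegral_indicator hA, setLIntegral_const, h1] at h2
  rw [mul_comm (μ A), ← h2]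
  rfl

/-- Some translate of `-B` meets `A` in at least the average measure. -/
lemma exists_measureReal_mul_le {A B : Set E} (hA : IsCompact A) (hB : IsCompact B)
    (hpos : 0 < μ.real (A + B)) :
    ∃ x, μ.real A * μ.real B ≤ μ.real (A + B) * μ.real (A ∩ {y | x - y ∈ B}) := by
  have hAB := hA.add hB
  have h := lintegral_measure_inter_sub μ hA.measurableSet hB.measurableSet
  have hsupp : ∫⁻ x in A + B, μ (A ∩ {y | x - y ∈ B}) ∂μ = μ A * μ B := by
    rw [← h]
    refine setLIntegral_eq_of_support_subset fun x hx => ?_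
    by_contra hx'
    refine hx ?_
    have : A ∩ {y | x - y ∈ B} = ∅ := by
      refine Set.eq_empty_of_forall_notMem fun y hy => hx' ⟨y, hy.1, x - y, hy.2, by simp⟩
    simp [this]
  have h0 : μ (A + B) ≠ 0 := fun h0 => by simp [Measure.real, h0] at hpos
  have htop : μ (A + B) ≠ ⊤ := hAB.measure_lt_top.ne
  obtain ⟨x, -, hx⟩ := exists_setLAverage_le (μ := μ) (s := A + B)
    (f := fun x => μ (A ∩ {y | x - y ∈ B})) h0 hAB.measurableSet.nullMeasurableSet
    (by rw [hsupp]; exact ENNReal.mul_ne_top hA.measure_lt_top.ne hB.measure_lt_top.ne)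
  refine ⟨x, ?_⟩
  rw [setLAverage_eq, hsupp, ENNReal.div_le_iff h0 htop, mul_comm _ (μ (A + B))] at hx
  have hfin : μ (A ∩ {y | x - y ∈ B}) ≠ ⊤ :=
    ((measure_mono Set.inter_subset_left).trans_lt hA.measure_lt_top).ne
  simpa [Measure.real] using ENNReal.toReal_mono (ENNReal.mul_ne_top htop hfin) hx

/-- Ruzsa's triangle inequality for Haar measure. -/
lemma measureReal_add_mul_le {A B C : Set E} (hA : IsCompact A) (hB : IsCompact B)
    (hC : IsCompact C) (hsymm : -C = C) :
    μ.real (A + B) * μ.real C ≤ μ.real (A + C) * μ.real (C + B) := by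
  have hAC := hA.add hC
  have hCB := hC.add hB
  have hAB := hA.add hB
  have key : μ (A + B) * μ C ≤ μ (A + C) * μ (C + B) := by
    rw [← lintegral_measure_inter_sub μ hAC.measurableSet hCB.measurableSet]
    calc μ (A + B) * μ C = ∫⁻ _ in A + B, μ C ∂μ := by rw [setLIntegral_const, mul_comm]
      _ ≤ ∫⁻ x in A + B, μ ((A + C) ∩ {y | x - y ∈ C + B}) ∂μ := by
        refine setLIntegral_mono' hAB.measurableSet ?_
        rintro _ ⟨a, ha, b, hb, rfl⟩
        -- For `x = a + b` the whole translate `a + C` lies in the intersection: `x - (a + c) = -c +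
        -- b`, and `-c ∈ C` by symmetry.
        rw [← measure_preimage_add μ a ((A + C) ∩ _)]
        refine measure_mono fun c hc => ⟨⟨a, ha, c, hc, rfl⟩, -c, ?_, b, hb, ?_⟩
        · rw [← hsymm]; simpa using hc
        · simp only; abel
      _ ≤ _ := setLIntegral_le_lintegral _ _
  simpa [Measure.real] using ENNReal.toReal_mono
    (ENNReal.mul_ne_top hAC.measure_lt_top.ne hCB.measure_lt_top.ne) key

/-- Ruzsa's inequality twice: through `K` to replace `A` by `K`, then through `L` to replace `B` by
`L`. -/
lemma measureReal_add_le_of_symm {A B K L : Set E} (hA : IsCompact A) (hB : IsCompact B)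
    (hK : IsCompact K) (hL : IsCompact L) (hKs : -K = K) (hLs : -L = L)
    (hK0 : 0 < μ.real K) (hL0 : 0 < μ.real L) {a b : ℝ} (ha : 0 ≤ a)
    (hAK : μ.real (A + K) ≤ a * μ.real K) (hBL : μ.real (B + L) ≤ b * μ.real L) :
    μ.real (A + B) ≤ a * b * μ.real (K + L) := by
  have h1 := measureReal_add_mul_le μ hA hB hK hKs
  have h2 := measureReal_add_mul_le μ hK hB hL hLs
  rw [add_comm L B] at h2
  have h3 : μ.real (K + B) ≤ b * μ.real (K + L) := by
    refine le_of_mul_le_mul_right (h2.trans ?_) hL0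
    calc _ ≤ μ.real (K + L) * (b * μ.real L) := by gcongr
      _ = _ := by ring
  refine le_of_mul_le_mul_right (h1.trans ?_) hK0
  calc _ ≤ (a * μ.real K) * (b * μ.real (K + L)) := by gcongr
    _ = _ := by ring

lemma Convex.measureReal_add_self {A : Set E} (hA : Convex ℝ A) :
    μ.real (A + A) = 2 ^ Module.finrank ℝ E * μ.real A := by
  have h : A + A = (2 : ℝ) • A := by
    have := hA.add_smul (p := 1) (q := 1) zero_le_one zero_le_one
    rw [one_smul] at this
    rw [← this]; norm_num
  rw [h, Measure.real, Measure.addHaar_smul]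
  simp [Measure.real]

/-- With empty interior, the set would lie in its frontier, which is null by convexity. -/
lemma Convex.interior_nonempty_of_measureReal_pos {A : Set E} (hA : Convex ℝ A)
    (hpos : 0 < μ.real A) : (interior A).Nonempty := by
  by_contra h
  rw [Set.not_nonempty_iff_eq_empty] at h
  have h1 : μ A ≤ μ (frontier A) := by
    refine measure_mono ?_
    rw [frontier, h, Set.sdiff_empty]
    exact subset_closure
  rw [hA.addHaar_frontier μ, nonpos_iff_eq_zero] at h1
  simp [Measure.real, h1] at hpos

/-- For a fixed `z` in the left-hand intersection, `y ↦ (y - z) / 2` maps that intersection into `A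
∩ B`, since both sets are convex and symmetric. -/
lemma measureReal_inter_translate_le {A B : Set E} (hA : Convex ℝ A) (hB : Convex ℝ B)
    (hAc : IsCompact A) (hAs : -A = A) (hBs : -B = B) (x : E) :
    μ.real (A ∩ {y | y - x ∈ B}) ≤ 2 ^ Module.finrank ℝ E * μ.real (A ∩ B) := by
  have half : ∀ {S : Set E}, Convex ℝ S → -S = S → ∀ {a b : E}, a ∈ S → b ∈ S →
      (1 / 2 : ℝ) • (a - b) ∈ S := by
    intro S hS hs a b ha hb
    have hb' : -b ∈ S := by rw [← hs]; simpa using hb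
    have := hS ha hb' (a := 1 / 2) (b := 1 / 2) (by norm_num) (by norm_num) (by norm_num)
    rwa [← smul_add, ← sub_eq_add_neg] at this
  rcases (A ∩ {y | y - x ∈ B}).eq_empty_or_nonempty with h | ⟨z, hzA, hzB⟩
  · rw [h, measureReal_empty]; positivity
  have hfin : μ (A ∩ B) ≠ ⊤ :=
    ((measure_mono Set.inter_subset_left).trans_lt hAc.measure_lt_top).ne
  have hsub : A ∩ {y | y - x ∈ B} ⊆ (fun y => y + -z) ⁻¹' ((2 : ℝ) • (A ∩ B)) := by
    rintro y ⟨hyA, hyB⟩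
    refine ⟨(1 / 2 : ℝ) • (y - z), ⟨half hA hAs hyA hzA, ?_⟩, ?_⟩
    · have := half hB hBs hyB hzB
      rwa [sub_sub_sub_cancel_right] at this
    · simp [smul_smul, sub_eq_add_neg]
  have h1 := measure_mono (μ := μ) hsub
  rw [measure_preimage_add_right, Measure.addHaar_smul] at h1
  have := ENNReal.toReal_mono (ENNReal.mul_ne_top ENNReal.ofReal_ne_top hfin) h1
  simpa [Measure.real] using this

/-- Since `|A + A| = 2^n |A|`, averaging gives `x` with `|A ∩ (x - A)| ≥ 2^{-n} |A|`. This set is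
symmetric about `x / 2`; `K` is its translate to the origin. As `A + K` sits in a translate of `A +
A`, the two factors `2^n` multiply to `4^n`. -/
lemma exists_symm_measureReal_add_le {A : Set E} (hA : Convex ℝ A) (hAc : IsCompact A)
    (hpos : 0 < μ.real A) :
    ∃ K : Set E, Convex ℝ K ∧ IsCompact K ∧ -K = K ∧ 0 < μ.real K ∧ μ.real K ≤ μ.real A ∧
      μ.real (A + K) ≤ 4 ^ Module.finrank ℝ E * μ.real K := by
  have h2 : (0 : ℝ) < 2 ^ Module.finrank ℝ E := by positivity
  have hAA := hA.measureReal_add_self μ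
  obtain ⟨x, hx⟩ := exists_measureReal_mul_le μ hAc hAc (by rw [hAA]; positivity)
  rw [hAA, mul_right_comm] at hx
  have hx' := le_of_mul_le_mul_right hx hpos
  set c : E := (1 / 2 : ℝ) • x with hc
  have hxc : x = c + c := by rw [hc, ← add_smul]; norm_num
  set K : Set E := (fun z => c + z) ⁻¹' (A ∩ {y | x - y ∈ A}) with hK
  have hmem : ∀ z, z ∈ K ↔ c + z ∈ A ∧ c - z ∈ A := by
    intro z
    simp only [hK, Set.mem_preimage, Set.mem_inter_iff, Set.mem_ofPred_eq, hxc,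
      add_sub_add_left_eq_sub]
  have hvol : μ.real K = μ.real (A ∩ {y | x - y ∈ A}) := by
    simp only [Measure.real, hK, measure_preimage_add]
  have hKA : μ.real K ≤ μ.real A := by
    rw [hvol]
    exact measureReal_mono Set.inter_subset_left hAc.measure_lt_top.ne
  have hAK : μ.real A ≤ 2 ^ Module.finrank ℝ E * μ.real K := by rwa [hvol]
  refine ⟨K, ?_, ?_, ?_, ?_, hKA, ?_⟩
  · intro z hz w hw a b ha hb hab
    rw [hmem] at hz hw ⊢
    have e : c = a • c + b • c := by rw [← add_smul, hab, one_smul]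
    constructor
    · have := hA hz.1 hw.1 ha hb hab
      rw [smul_add, smul_add, add_add_add_comm, ← e] at this
      exact this
    · have := hA hz.2 hw.2 ha hb hab
      rw [smul_sub, smul_sub, sub_add_sub_comm, ← e] at this
      exact this
  · have h1 : IsCompact ((fun z => c + z) ⁻¹' A) := (Homeomorph.addLeft c).isCompact_preimage.2 hAc
    have h3 : IsClosed {y | x - y ∈ A} := hAc.isClosed.preimage (by fun_prop)
    exact h1.inter_right (h3.preimage (by fun_prop : Continuous fun z => c + z))
  · ext z
    rw [Set.mem_neg, hmem, hmem, sub_neg_eq_add, ← sub_eq_add_neg, and_comm]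
  · by_contra h
    nlinarith [not_lt.1 h]
  · have hsub : A + K ⊆ (fun z => c + z) ⁻¹' (A + A) := by
      rintro _ ⟨a, ha, z, hz, rfl⟩
      exact ⟨a, ha, c + z, ((hmem z).1 hz).1, by simp only; abel⟩
    have h1 : μ.real (A + K) ≤ μ.real (A + A) := by
      have h := measure_mono (μ := μ) hsub
      rw [measure_preimage_add] at h
      exact ENNReal.toReal_mono (hAc.add hAc).measure_lt_top.ne h
    calc _ ≤ 2 ^ Module.finrank ℝ E * (2 ^ Module.finrank ℝ E * μ.real K) := by
          rw [hAA] at h1; exact h1.trans (by gcongr)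
      _ = _ := by rw [← mul_assoc, ← mul_pow]; norm_num

end Haar

/-! ### Volume radii, balls and volume preserving maps. -/

section Euclidean

variable {n : ℕ}

lemma volRoot_nonneg (A : Set (EuclideanSpace ℝ (Fin n))) : 0 ≤ volRoot A :=
  Real.rpow_nonneg measureReal_nonneg _

lemma volRoot_pow (hn : 1 ≤ n) (A : Set (EuclideanSpace ℝ (Fin n))) :
    volRoot A ^ n = volume.real A := by
  rw [volRoot, one_div, Real.rpow_inv_natCast_pow measureReal_nonneg (by omega)]

lemma volRoot_le_iff (hn : 1 ≤ n) {A B : Set (EuclideanSpace ℝ (Fin n))} {q : ℝ} (hq : 0 ≤ q) :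
    volRoot A ≤ q * volRoot B ↔ volume.real A ≤ q ^ n * volume.real B := by
  rw [← volRoot_pow hn A, ← volRoot_pow hn B, ← mul_pow,
    pow_le_pow_iff_left₀ (volRoot_nonneg A) (mul_nonneg hq (volRoot_nonneg B)) (by omega)]

lemma mul_volRoot_le_iff (hn : 1 ≤ n) {A B : Set (EuclideanSpace ℝ (Fin n))} {q : ℝ}
    (hq : 0 ≤ q) : q * volRoot A ≤ volRoot B ↔ q ^ n * volume.real A ≤ volume.real B := by
  rw [← volRoot_pow hn A, ← volRoot_pow hn B, ← mul_pow,
    pow_le_pow_iff_left₀ (mul_nonneg hq (volRoot_nonneg A)) (volRoot_nonneg B) (by omega)]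

lemma volRoot_congr {A B : Set (EuclideanSpace ℝ (Fin n))} (h : volume A = volume B) :
    volRoot A = volRoot B := by
  simp only [volRoot, Measure.real, h]

lemma volRoot_mono {A B : Set (EuclideanSpace ℝ (Fin n))} (h : A ⊆ B) (hB : IsCompact B) :
    volRoot A ≤ volRoot B :=
  Real.rpow_le_rpow measureReal_nonneg (measureReal_mono h hB.measure_lt_top.ne) (by positivity)

lemma volRoot_closedBall (hn : 1 ≤ n) {r : ℝ} (hr : 0 ≤ r) :
    volRoot (Metric.closedBall (0 : EuclideanSpace ℝ (Fin n)) r) =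
      r * volRoot (Metric.closedBall (0 : EuclideanSpace ℝ (Fin n)) 1) := by
  have : volume.real (Metric.closedBall (0 : EuclideanSpace ℝ (Fin n)) r) =
      r ^ n * volume.real (Metric.closedBall (0 : EuclideanSpace ℝ (Fin n)) 1) := by
    rw [Measure.real, Measure.addHaar_closedBall' _ _ hr]
    simp [Measure.real, hr]
  refine le_antisymm ?_ ?_
  · rw [volRoot_le_iff hn hr, this]
  · rw [mul_volRoot_le_iff hn hr, this]

lemma volRoot_closedBall_add (hn : 1 ≤ n) {r s : ℝ} (hr : 0 ≤ r) (hs : 0 ≤ s) :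
    volRoot (Metric.closedBall (0 : EuclideanSpace ℝ (Fin n)) r + Metric.closedBall 0 s) =
      volRoot (Metric.closedBall (0 : EuclideanSpace ℝ (Fin n)) r) +
        volRoot (Metric.closedBall (0 : EuclideanSpace ℝ (Fin n)) s) := by
  rw [closedBall_add_closedBall hr hs, add_zero, volRoot_closedBall hn (add_nonneg hr hs),
    volRoot_closedBall hn hr, volRoot_closedBall hn hs, add_mul]

lemma IsConvBody.measureReal_pos {A : Set (EuclideanSpace ℝ (Fin n))} (hA : IsConvBody A) :
    0 < volume.real A :=
  ENNReal.toReal_pos (Measure.measure_pos_of_nonempty_interior _ hA.2.2).ne' hA.2.1.measure_lt_top.ne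

lemma IsConvBody.volRoot_pos {A : Set (EuclideanSpace ℝ (Fin n))} (hA : IsConvBody A) :
    0 < volRoot A :=
  Real.rpow_pos_of_pos hA.measureReal_pos _

lemma isSymmConvBody_closedBall {r : ℝ} (hr : 0 < r) :
    IsSymmConvBody (Metric.closedBall (0 : EuclideanSpace ℝ (Fin n)) r) := by
  refine ⟨⟨convex_closedBall _ _, isCompact_closedBall _ _, 0, ?_⟩, by simp⟩
  exact mem_interior_iff_mem_nhds.2 (Metric.closedBall_mem_nhds _ hr)

lemma exists_closedBall_volume_eq (hn : 1 ≤ n) {A : Set (EuclideanSpace ℝ (Fin n))}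
    (hA : IsConvBody A) :
    ∃ r : ℝ, 0 < r ∧ volume (Metric.closedBall (0 : EuclideanSpace ℝ (Fin n)) r) = volume A := by
  set b := volRoot (Metric.closedBall (0 : EuclideanSpace ℝ (Fin n)) 1) with hb
  have hbpos : 0 < b := (isSymmConvBody_closedBall one_pos).1.volRoot_pos
  have hr : 0 < volRoot A / b := div_pos hA.volRoot_pos hbpos
  refine ⟨volRoot A / b, hr, ?_⟩
  rw [← ENNReal.toReal_eq_toReal_iff' (isCompact_closedBall _ _).measure_lt_top.ne
    hA.2.1.measure_lt_top.ne]
  change volume.real _ = volume.real _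
  rw [← volRoot_pow hn, ← volRoot_pow hn, volRoot_closedBall hn hr.le,
    div_mul_cancel₀ _ hbpos.ne']

lemma MeasureTheory.MeasurePreserving.volume_image_linearEquiv
    {u : EuclideanSpace ℝ (Fin n) ≃ₗ[ℝ] EuclideanSpace ℝ (Fin n)}
    (hu : MeasurePreserving u volume volume) {A : Set (EuclideanSpace ℝ (Fin n))}
    (hA : IsCompact A) : volume (u '' A) = volume A := by
  have hc : IsCompact (u '' A) := hA.image u.toContinuousLinearEquiv.continuous
  rw [← hu.measure_preimage hc.measurableSet.nullMeasurableSet,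
    Set.preimage_image_eq _ u.injective]

lemma IsConvBody.image {A : Set (EuclideanSpace ℝ (Fin n))} (hA : IsConvBody A)
    (u : EuclideanSpace ℝ (Fin n) ≃ₗ[ℝ] EuclideanSpace ℝ (Fin n)) : IsConvBody (u '' A) := by
  refine ⟨hA.1.linear_image u.toLinearMap, hA.2.1.image u.toContinuousLinearEquiv.continuous, ?_⟩
  have := u.toContinuousLinearEquiv.toHomeomorph.image_interior A
  have h2 := hA.2.2.image u
  exact (congrArg Set.Nonempty this).mp h2

lemma IsSymmConvBody.image {A : Set (EuclideanSpace ℝ (Fin n))} (hA : IsSymmConvBody A)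
    (u : EuclideanSpace ℝ (Fin n) ≃ₗ[ℝ] EuclideanSpace ℝ (Fin n)) : IsSymmConvBody (u '' A) :=
  ⟨hA.1.image u, by rw [← Set.image_neg u, hA.2]⟩

/-! ### From `M`-ellipsoids to reverse Brunn-Minkowski. -/

/-- Two symmetric convex bodies in `M`-position satisfy the reverse Brunn-Minkowski inequality. -/
lemma InMPosition.volRoot_add_le (hn : 1 ≤ n) {c : ℝ} (hc : 0 < c)
    {A B : Set (EuclideanSpace ℝ (Fin n))} (hA : IsSymmConvBody A) (hB : IsSymmConvBody B)
    (hAc : InMPosition c A) (hBc : InMPosition c B) :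
    volRoot (A + B) ≤ 2 / c * (2 / c) * (volRoot A + volRoot B) := by
  obtain ⟨r, hr, hrA, hr'⟩ := hAc
  obtain ⟨s, hs, hsB, hs'⟩ := hBc
  have aux : ∀ {A : Set (EuclideanSpace ℝ (Fin n))} {r : ℝ}, IsSymmConvBody A →
      c * volRoot A ≤ volRoot (A ∩ Metric.closedBall 0 r) →
      0 < volume.real (A ∩ Metric.closedBall 0 r) ∧
      volume.real (A + A ∩ Metric.closedBall 0 r) ≤
        (2 / c) ^ n * volume.real (A ∩ Metric.closedBall 0 r) := by
    intro A r hA h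
    rw [mul_volRoot_le_iff hn hc.le] at h
    have hcn : 0 < c ^ n := pow_pos hc n
    refine ⟨(mul_pos hcn hA.1.measureReal_pos).trans_le h, ?_⟩
    have h1 : volume.real (A + A ∩ Metric.closedBall 0 r) ≤ volume.real (A + A) :=
      measureReal_mono (Set.add_subset_add_left Set.inter_subset_left)
        (hA.1.2.1.add hA.1.2.1).measure_lt_top.ne
    rw [hA.1.1.measureReal_add_self volume, finrank_euclideanSpace_fin] at h1
    refine h1.trans ?_
    rw [div_pow, div_mul_eq_mul_div, le_div_iff₀ hcn, mul_assoc, mul_comm (volume.real A)]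
    gcongr
  obtain ⟨hK0, hK⟩ := aux hA hr'
  obtain ⟨hL0, hL⟩ := aux hB hs'
  have hKc : IsCompact (A ∩ Metric.closedBall 0 r) := hA.1.2.1.inter (isCompact_closedBall _ _)
  have hLc : IsCompact (B ∩ Metric.closedBall 0 s) := hB.1.2.1.inter (isCompact_closedBall _ _)
  have h := measureReal_add_le_of_symm volume hA.1.2.1 hB.1.2.1 hKc hLc
    (by rw [Set.inter_neg, hA.2]; simp) (by rw [Set.inter_neg, hB.2]; simp) hK0 hL0
    (by positivity) hK hL
  rw [← mul_pow] at h
  refine ((volRoot_le_iff hn (by positivity)).2 h).trans ?_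
  gcongr
  rw [← volRoot_congr hrA, ← volRoot_congr hsB, ← volRoot_closedBall_add hn hr.le hs.le]
  exact volRoot_mono (Set.add_subset_add Set.inter_subset_right Set.inter_subset_right)
    ((isCompact_closedBall _ _).add (isCompact_closedBall _ _))

/-- A symmetric convex body with an `M`-ellipsoid has a linear volume preserving image in
`M`-position. -/
lemma IsMEllipsoid.exists_inMPosition (hn : 1 ≤ n) {c : ℝ}
    {A E : Set (EuclideanSpace ℝ (Fin n))} (hA : IsSymmConvBody A) (hE : IsMEllipsoid c A E) :
    ∃ u : EuclideanSpace ℝ (Fin n) ≃ₗ[ℝ] EuclideanSpace ℝ (Fin n),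
      MeasurePreserving u volume volume ∧ InMPosition (c / 2) (u '' A) := by
  obtain ⟨⟨T, rfl⟩, hvol, hcE⟩ := hE
  set L : EuclideanSpace ℝ (Fin n) ≃ₗ[ℝ] EuclideanSpace ℝ (Fin n) := T.linear with hL
  set D : Set (EuclideanSpace ℝ (Fin n)) := Metric.closedBall 0 1 with hD
  have hDb : IsSymmConvBody D := isSymmConvBody_closedBall one_pos
  have hLD : IsSymmConvBody (L '' D) := hDb.image L
  have hT : ∀ x, T x = L x + T 0 := fun x => by
    have := T.map_vadd 0 x
    simpa using this
  have hTD : T '' D = {y | y - T 0 ∈ L '' D} := by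
    ext y
    rw [Set.mem_ofPred_eq]
    constructor
    · rintro ⟨z, hz, rfl⟩
      exact ⟨z, hz, by rw [hT z, add_sub_cancel_right]⟩
    · rintro ⟨z, hz, hzy⟩
      exact ⟨z, hz, by rw [hT z, hzy, sub_add_cancel]⟩
  have hvolL : volume (L '' D) = volume A := by
    rw [← hvol, hTD, ← measure_preimage_add_right volume (-T 0) (L '' D)]
    simp only [← sub_eq_add_neg]; rfl
  obtain ⟨r, hr, hrA⟩ := exists_closedBall_volume_eq hn hA.1
  -- `u = r L⁻¹` carries the recentred ellipsoid to the ball of equal volume; preserving the volume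
  -- of this one set forces `|det u| = 1`.
  set u := L.symm.trans (LinearEquiv.smulOfNeZero ℝ (EuclideanSpace ℝ (Fin n)) r hr.ne') with hu
  have huL : u '' (L '' D) = Metric.closedBall 0 r := by
    have : u '' (L '' D) = r • D := by
      rw [← Set.image_comp]
      refine Set.image_congr fun x _ => ?_
      simp [hu]
    rw [this, hD, smul_unitClosedBall_of_nonneg hr.le]
  have hpres : MeasurePreserving u volume volume := by
    have hdet : LinearMap.det (u : EuclideanSpace ℝ (Fin n) →ₗ[ℝ] EuclideanSpace ℝ (Fin n)) ≠ 0 :=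
      u.isUnit_det'.ne_zero
    have himg := Measure.addHaar_image_linearMap volume
      (u : EuclideanSpace ℝ (Fin n) →ₗ[ℝ] EuclideanSpace ℝ (Fin n)) (L '' D)
    have hpos : volume (L '' D) ≠ 0 := (Measure.measure_pos_of_nonempty_interior _ hLD.1.2.2).ne'
    have hone : ENNReal.ofReal |LinearMap.det
        (u : EuclideanSpace ℝ (Fin n) →ₗ[ℝ] EuclideanSpace ℝ (Fin n))| = 1 := by
      have h1 : volume (u '' (L '' D)) = volume (L '' D) := by rw [huL, hrA, hvolL]
      have h2 := himg.symm.trans h1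
      exact (ENNReal.mul_eq_right hpos hLD.1.2.1.measure_lt_top.ne).1 h2
    refine ⟨u.toContinuousLinearEquiv.continuous.measurable, ?_⟩
    have := Measure.map_linearMap_addHaar_eq_smul_addHaar volume hdet
    rw [abs_inv, ENNReal.ofReal_inv_of_pos (abs_pos.2 hdet), hone, inv_one, one_smul] at this
    exact this
  refine ⟨u, hpres, r, hr, ?_, ?_⟩
  · rw [hrA, hpres.volume_image_linearEquiv hA.1.2.1]
  · rw [← huL, ← Set.image_inter u.injective,
      volRoot_congr (hpres.volume_image_linearEquiv hA.1.2.1),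
      volRoot_congr (hpres.volume_image_linearEquiv (hA.1.2.1.inter hLD.1.2.1))]
    have h := measureReal_inter_translate_le volume hA.1.1 hLD.1.1 hA.1.2.1 hA.2 hLD.2 (T 0)
    rw [finrank_euclideanSpace_fin, ← hTD, ← volRoot_le_iff hn two_pos.le] at h
    linarith

/-! ### From reverse Brunn-Minkowski to `M`-ellipsoids. -/

/-- If `|A + B|` is comparable to `|A| = |B|`, some translate of `-B` has large intersection
with `A`. -/
lemma exists_volRoot_inter_ge (hn : 1 ≤ n) {C : ℝ} (hC : 0 < C)
    {A B : Set (EuclideanSpace ℝ (Fin n))} (hA : IsConvBody A) (hB : IsConvBody B)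
    (hvol : volume B = volume A) (h : volRoot (A + B) ≤ C * (volRoot A + volRoot B)) :
    ∃ x, 1 / (2 * C) * volRoot A ≤ volRoot (A ∩ {y | x - y ∈ B}) := by
  have h' : volRoot (A + B) ≤ 2 * C * volRoot A := by
    rw [volRoot_congr hvol] at h; linarith
  rw [volRoot_le_iff hn (by positivity)] at h'
  have hpos : 0 < volume.real (A + B) := by
    obtain ⟨b, hb⟩ := hB.2.2
    refine ENNReal.toReal_pos (fun h0 => ?_) (hA.2.1.add hB.2.1).measure_lt_top.ne
    have h1 : volume ((fun x => x + b) '' A) ≤ volume (A + B) :=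
      measure_mono (Set.image_subset_iff.2 fun a ha => ⟨a, ha, b, interior_subset hb, rfl⟩)
    rw [h0, nonpos_iff_eq_zero, Set.image_add_right, measure_preimage_add_right] at h1
    exact (Measure.measure_pos_of_nonempty_interior _ hA.2.2).ne' h1
  obtain ⟨x, hx⟩ := exists_measureReal_mul_le volume hA.2.1 hB.2.1 hpos
  refine ⟨x, (mul_volRoot_le_iff hn (by positivity)).2 ?_⟩
  have hBA : volume.real B = volume.real A := by simp only [Measure.real, hvol]
  rw [hBA] at hx
  have hC2 : 0 < (2 * C) ^ n := by positivity
  rw [div_pow, one_pow, div_mul_eq_mul_div, one_mul, div_le_iff₀ hC2]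
  refine le_of_mul_le_mul_right (hx.trans ?_) hA.measureReal_pos
  calc _ ≤ (2 * C) ^ n * volume.real A * volume.real (A ∩ {y | x - y ∈ B}) := by gcongr
    _ = _ := by ring

lemma inMPosition_of_volRoot_add_closedBall_le (hn : 1 ≤ n) {C : ℝ} (hC : 0 < C)
    {A : Set (EuclideanSpace ℝ (Fin n))} {r : ℝ} (hA : IsSymmConvBody A) (hr : 0 < r)
    (hvol : volume (Metric.closedBall (0 : EuclideanSpace ℝ (Fin n)) r) = volume A)
    (h : volRoot (A + Metric.closedBall 0 r) ≤
      C * (volRoot A + volRoot (Metric.closedBall (0 : EuclideanSpace ℝ (Fin n)) r))) :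
    InMPosition (1 / (2 * C) / 2) A := by
  have hD : IsSymmConvBody (Metric.closedBall (0 : EuclideanSpace ℝ (Fin n)) r) :=
    isSymmConvBody_closedBall hr
  obtain ⟨x, hx⟩ := exists_volRoot_inter_ge hn hC hA.1 hD.1 hvol h
  have h1 := measureReal_inter_translate_le volume hA.1.1 hD.1.1 hA.1.2.1 hA.2 hD.2 x
  rw [finrank_euclideanSpace_fin, ← volRoot_le_iff hn two_pos.le] at h1
  have hset : {y | x - y ∈ Metric.closedBall (0 : EuclideanSpace ℝ (Fin n)) r} =
      {y | y - x ∈ Metric.closedBall (0 : EuclideanSpace ℝ (Fin n)) r} := by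
    ext y; simp [norm_sub_rev]
  rw [hset] at hx
  exact ⟨r, hr, hvol, by linarith⟩

lemma ReverseBM.exists_isMEllipsoid (hn : 1 ≤ n) {C : ℝ} (hC : 0 < C)
    {A : Set (EuclideanSpace ℝ (Fin n))} {r : ℝ} (hA : IsConvBody A) (hr : 0 < r)
    (hvol : volume (Metric.closedBall (0 : EuclideanSpace ℝ (Fin n)) r) = volume A)
    (h : ReverseBM C A (Metric.closedBall 0 r)) :
    ∃ E, IsMEllipsoid (1 / (2 * C)) A E := by
  obtain ⟨u, v, hu, hv, h⟩ := h
  set D := Metric.closedBall (0 : EuclideanSpace ℝ (Fin n)) r with hDdef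
  have hD : IsSymmConvBody D := isSymmConvBody_closedBall hr
  have huA := hu.volume_image_linearEquiv hA.2.1
  have hvD := hv.volume_image_linearEquiv hD.1.2.1
  obtain ⟨x, hx⟩ := exists_volRoot_inter_ge hn hC (hA.image u) (hD.1.image v)
    (by rw [huA, hvD, hvol]) (by rwa [volRoot_congr huA, volRoot_congr hvD])
  -- The ellipsoid is `u⁻¹(x + v D)`, equal to `u⁻¹(x - v D)` because `D` is symmetric.
  set T : EuclideanSpace ℝ (Fin n) ≃ᵃ[ℝ] EuclideanSpace ℝ (Fin n) :=
    (((LinearEquiv.smulOfNeZero ℝ (EuclideanSpace ℝ (Fin n)) r hr.ne').trans v).toAffineEquiv.trans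
      (AffineEquiv.constVAdd ℝ (EuclideanSpace ℝ (Fin n)) x)).trans u.symm.toAffineEquiv with hT
  have hTD : T '' Metric.closedBall 0 1 = u ⁻¹' {y | x - y ∈ v '' D} := by
    have h1 : T '' Metric.closedBall 0 1 = (fun z => u.symm (x + v z)) '' D := by
      have : D = r • Metric.closedBall (0 : EuclideanSpace ℝ (Fin n)) 1 := by
        rw [smul_unitClosedBall_of_nonneg hr.le]
      rw [this, ← Set.image_smul, ← Set.image_comp]
      refine Set.image_congr fun z _ => ?_
      simp [hT]
    rw [h1]
    ext y
    simp only [Set.mem_image, Set.mem_preimage, Set.mem_ofPred_eq]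
    constructor
    · rintro ⟨z, hz, rfl⟩
      refine ⟨-z, ?_, by simp⟩
      rw [← hD.2]; simpa using hz
    · rintro ⟨z, hz, hzy⟩
      refine ⟨-z, ?_, ?_⟩
      · rw [← hD.2]; simpa using hz
      · rw [map_neg, hzy, LinearEquiv.symm_apply_eq]; abel
  have hclosed : IsClosed {y | x - y ∈ v '' D} :=
    (hD.1.image v).2.1.isClosed.preimage (by fun_prop)
  refine ⟨T '' Metric.closedBall 0 1, ⟨T, rfl⟩, ?_, ?_⟩
  · rw [hTD, hu.measure_preimage hclosed.measurableSet.nullMeasurableSet, ← hvol, ← hvD]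
    exact (volume.measurePreserving_sub_left x).measure_preimage
      (hD.1.image v).2.1.measurableSet.nullMeasurableSet
  · rw [hTD]
    have himg : u '' A ∩ {y | x - y ∈ v '' D} = u '' (A ∩ u ⁻¹' {y | x - y ∈ v '' D}) := by
      rw [Set.image_inter_preimage]
    have hcomp : IsCompact (A ∩ u ⁻¹' {y | x - y ∈ v '' D}) :=
      hA.2.1.inter_right (hclosed.preimage u.toContinuousLinearEquiv.continuous)
    rwa [himg, volRoot_congr (hu.volume_image_linearEquiv hcomp), volRoot_congr huA] at hx

/-! ### Removing symmetry, and the supremum `M(A)`. -/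

lemma IsConvBody.exists_isSymmConvBody {A : Set (EuclideanSpace ℝ (Fin n))}
    (hA : IsConvBody A) : ∃ K, IsSymmConvBody K ∧ volume.real K ≤ volume.real A ∧
      volume.real (A + K) ≤ 4 ^ n * volume.real K := by
  obtain ⟨K, h1, h2, h3, h4, h5, h6⟩ :=
    exists_symm_measureReal_add_le volume hA.1 hA.2.1 hA.measureReal_pos
  rw [finrank_euclideanSpace_fin] at h6
  exact ⟨K, ⟨⟨h1, h2, h1.interior_nonempty_of_measureReal_pos volume h4⟩, h3⟩, h5, h6⟩

/-- The maps chosen for the symmetric parts `K`, `L` also serve `A`, `B`; each replacement costs a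
factor 4 by Ruzsa. -/
lemma reverseBM_of_symm (hn : 1 ≤ n) {C : ℝ} (hC : 0 < C)
    (h : ∀ A B : Set (EuclideanSpace ℝ (Fin n)), IsSymmConvBody A → IsSymmConvBody B →
      ReverseBM C A B) {A B : Set (EuclideanSpace ℝ (Fin n))} (hA : IsConvBody A)
    (hB : IsConvBody B) : ReverseBM (4 * 4 * C) A B := by
  obtain ⟨K, hK, hKA, hAK⟩ := hA.exists_isSymmConvBody
  obtain ⟨L, hL, hLB, hBL⟩ := hB.exists_isSymmConvBody
  obtain ⟨u, v, hu, hv, huv⟩ := h K L hK hL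
  refine ⟨u, v, hu, hv, ?_⟩
  have aux : ∀ {u : EuclideanSpace ℝ (Fin n) ≃ₗ[ℝ] EuclideanSpace ℝ (Fin n)}
      {A K : Set (EuclideanSpace ℝ (Fin n))}, MeasurePreserving u volume volume → IsConvBody A →
      IsConvBody K → volume.real (A + K) ≤ 4 ^ n * volume.real K →
      volume.real (u '' A + u '' K) ≤ 4 ^ n * volume.real (u '' K) := by
    intro u A K hu hA hK h
    rw [← Set.image_add, Measure.real, Measure.real,
      hu.volume_image_linearEquiv (hA.2.1.add hK.2.1), hu.volume_image_linearEquiv hK.2.1]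
    exact h
  have key := measureReal_add_le_of_symm volume (hA.image u).2.1 (hB.image v).2.1
    (hK.image u).1.2.1 (hL.image v).1.2.1 (hK.image u).2 (hL.image v).2
    (hK.image u).1.measureReal_pos (hL.image v).1.measureReal_pos (by positivity)
    (aux hu hA hK.1 hAK) (aux hv hB hL.1 hBL)
  rw [← mul_pow, ← volRoot_le_iff hn (by norm_num)] at key
  have hle : ∀ {S T : Set (EuclideanSpace ℝ (Fin n))}, volume.real S ≤ volume.real T →
      volRoot S ≤ volRoot T := fun h =>
    Real.rpow_le_rpow measureReal_nonneg h (by positivity)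
  calc _ ≤ 4 * 4 * volRoot (u '' K + v '' L) := key
    _ ≤ 4 * 4 * (C * (volRoot A + volRoot B)) := by
      gcongr
      exact huv.trans (by gcongr <;> exact hle ‹_›)
    _ = _ := by ring

lemma exists_isEllipsoid_volume_eq (hn : 1 ≤ n) {A : Set (EuclideanSpace ℝ (Fin n))}
    (hA : IsConvBody A) : ∃ E : Set (EuclideanSpace ℝ (Fin n)), IsEllipsoid E ∧ volume E = volume A := by
  obtain ⟨r, hr, h⟩ := exists_closedBall_volume_eq hn hA
  refine ⟨_, ⟨(LinearEquiv.smulOfNeZero ℝ (EuclideanSpace ℝ (Fin n)) r hr.ne').toAffineEquiv, ?_⟩, h⟩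
  rw [← smul_unitClosedBall_of_nonneg hr.le]
  rfl

lemma IsMEllipsoid.le_milmanM {c : ℝ} {A E : Set (EuclideanSpace ℝ (Fin n))} (hA : IsConvBody A)
    (hE : IsMEllipsoid c A E) : c ≤ milmanM A := by
  refine le_csSup_of_le ⟨1, ?_⟩ ⟨E, hE.1, hE.2.1, rfl⟩ ((le_div_iff₀ hA.volRoot_pos).2 hE.2.2)
  rintro _ ⟨F, -, -, rfl⟩
  exact (div_le_one hA.volRoot_pos).2 (volRoot_mono Set.inter_subset_left hA.2.1)

lemma exists_isMEllipsoid_of_lt_milmanM (hn : 1 ≤ n) {c : ℝ}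
    {A : Set (EuclideanSpace ℝ (Fin n))} (hA : IsConvBody A) (h : c < milmanM A) :
    ∃ E, IsMEllipsoid c A E := by
  -- A ball of the right volume makes the set under `sSup` nonempty, so some ellipsoid exceeds `c`.
  obtain ⟨E₀, hE₀, hv₀⟩ := exists_isEllipsoid_volume_eq hn hA
  rw [milmanM] at h
  obtain ⟨_, ⟨E, hE, hv, rfl⟩, hlt⟩ := exists_lt_of_lt_csSup (by exact ⟨_, E₀, hE₀, hv₀, rfl⟩) h
  exact ⟨E, hE, hv, ((lt_div_iff₀ hA.volRoot_pos).1 hlt).le⟩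

lemma reverseBM_of_isMEllipsoid (hn : 1 ≤ n) {c : ℝ} (hc : 0 < c)
    {A B E F : Set (EuclideanSpace ℝ (Fin n))} (hA : IsSymmConvBody A) (hB : IsSymmConvBody B)
    (hE : IsMEllipsoid c A E) (hF : IsMEllipsoid c B F) :
    ReverseBM (2 / (c / 2) * (2 / (c / 2))) A B := by
  obtain ⟨u, hu, hu'⟩ := hE.exists_inMPosition hn hA
  obtain ⟨v, hv, hv'⟩ := hF.exists_inMPosition hn hB
  have h := hu'.volRoot_add_le hn (half_pos hc) (hA.image u) (hB.image v) hv'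
  rw [volRoot_congr (hu.volume_image_linearEquiv hA.1.2.1),
    volRoot_congr (hv.volume_image_linearEquiv hB.1.2.1)] at h
  exact ⟨u, v, hu, hv, h⟩

end Euclidean

theorem mainTheorem7 :
    -- the equivalence, with universal (dimension-free) constants
    List.TFAE [
      -- `M(A) ≥ c` for all symmetric convex bodies
      ∃ c : ℝ, 0 < c ∧ ∀ n : ℕ, 1 ≤ n → ∀ A : Set (EuclideanSpace ℝ (Fin n)),
        IsSymmConvBody A → c ≤ milmanM A,
      -- existence of `M`-ellipsoids for all symmetric convex bodies
      ∃ c : ℝ, 0 < c ∧ ∀ n : ℕ, 1 ≤ n → ∀ A : Set (EuclideanSpace ℝ (Fin n)),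
        IsSymmConvBody A → ∃ E : Set (EuclideanSpace ℝ (Fin n)), IsMEllipsoid c A E,
      -- the reverse Brunn-Minkowski inequality for symmetric convex bodies
      ∃ C : ℝ, 0 < C ∧ ∀ n : ℕ, 1 ≤ n → ∀ A B : Set (EuclideanSpace ℝ (Fin n)),
        IsSymmConvBody A → IsSymmConvBody B → ReverseBM C A B,
      -- the reverse Brunn-Minkowski inequality for all convex bodies
      ∃ C : ℝ, 0 < C ∧ ∀ n : ℕ, 1 ≤ n → ∀ A B : Set (EuclideanSpace ℝ (Fin n)),
        IsConvBody A → IsConvBody B → ReverseBM C A B] ∧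
    -- bodies in `M`-position satisfy the reverse inequality without further linear maps
    (∀ c : ℝ, 0 < c → ∃ C : ℝ, 0 < C ∧ ∀ n : ℕ, 1 ≤ n →
      ∀ A B : Set (EuclideanSpace ℝ (Fin n)), IsSymmConvBody A → IsSymmConvBody B →
        InMPosition c A → InMPosition c B →
          volRoot (A + B) ≤ C * (volRoot A + volRoot B)) ∧
    -- conversely, the reverse inequality for a body and the ball of the same volume gives
    -- `M`-position of the body
    (∀ C : ℝ, 0 < C → ∃ c : ℝ, 0 < c ∧ ∀ n : ℕ, 1 ≤ n →
      ∀ (A : Set (EuclideanSpace ℝ (Fin n))) (r : ℝ), IsSymmConvBody A → 0 < r →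
        volume (Metric.closedBall (0 : EuclideanSpace ℝ (Fin n)) r) = volume A →
          volRoot (A + Metric.closedBall 0 r)
              ≤ C * (volRoot A + volRoot (Metric.closedBall (0 : EuclideanSpace ℝ (Fin n)) r)) →
            InMPosition c A) := by
  refine ⟨?_, fun c hc => ⟨2 / c * (2 / c), by positivity, fun n hn A B hA hB hAc hBc =>
    hAc.volRoot_add_le hn hc hA hB hBc⟩, fun C hC => ⟨1 / (2 * C) / 2, by positivity,
    fun n hn A r hA hr hvol h => inMPosition_of_volRoot_add_closedBall_le hn hC hA hr hvol h⟩⟩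
  -- Halving `c` gives strict inequality, so attainment of the supremum is not needed.
  tfae_have 1 → 2 := fun ⟨c, hc, h⟩ => ⟨c / 2, half_pos hc, fun n hn A hA =>
    exists_isMEllipsoid_of_lt_milmanM hn hA.1 ((half_lt_self hc).trans_le (h n hn A hA))⟩
  tfae_have 2 → 1 := fun ⟨c, hc, h⟩ => ⟨c, hc, fun n hn A hA =>
    let ⟨_, hE⟩ := h n hn A hA
    hE.le_milmanM hA.1⟩
  tfae_have 2 → 3 := fun ⟨c, hc, h⟩ => ⟨2 / (c / 2) * (2 / (c / 2)), by positivity,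
    fun n hn A B hA hB =>
      let ⟨_, hE⟩ := h n hn A hA
      let ⟨_, hF⟩ := h n hn B hB
      reverseBM_of_isMEllipsoid hn hc hA hB hE hF⟩
  tfae_have 3 → 2 := fun ⟨C, hC, h⟩ => ⟨1 / (2 * C), by positivity, fun n hn A hA =>
    let ⟨r, hr, hvol⟩ := exists_closedBall_volume_eq hn hA.1
    (h n hn A _ hA (isSymmConvBody_closedBall hr)).exists_isMEllipsoid hn hC hA.1 hr hvol⟩
  tfae_have 3 → 4 := fun ⟨C, hC, h⟩ => ⟨4 * 4 * C, by positivity, fun n hn _ _ hA hB =>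
    reverseBM_of_symm hn hC (h n hn) hA hB⟩
  tfae_have 4 → 3 := fun ⟨C, hC, h⟩ => ⟨C, hC, fun n hn A B hA hB => h n hn A B hA.1 hB.1⟩
  tfae_finish
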